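/- **Notation.** For $C\subseteq\mathbb{R}^p$ and $x\in C$ let $T_C(x)=\limsup_{t\searrow 0}\frac{C-x}{t}$ (outer limit) be the tangent (contingent) cone, $\widehat N_C(x)=\{v\mid \limsup_{x'\to x,\,x'\in C,\,x'\ne x}\frac{\langle v,x'-x\rangle}{\|x'-x\|}\le 0\}$ the regular normal cone, and $N_C(x)$ the limiting normal cone, i.e. the set of all limits of sequences $v_k\in\widehat N_C(x_k)$ with $x_k\in C$, $x_k\to x$; these sets are empty if $x\notin C$. For $A\subseteq\mathbb{R}^p$, $\mathrm{proj}_C A=\{y\in C\mid \exists a\in A:\ \|a-y\|=d(a,C)\}$. The set $C$ is locally closed at $x$ if $C\cap U$ is closed for some closed neighborhood $U$ of $x$. $\mathbb{B}$ denotes the closed unit ball. For a set-valued mapping $S:\mathbb{R}^n\rightrightarrows\mathbb{R}^m$ let $\mathrm{gph}\,S=\{(x,u)\mid u\in S(x)\}$, and for $X\subseteq\mathbb{R}^n$ let $S|_X$ equal $S$ on $X$ and $\emptyset$ off $X$. The coderivative of $S$ at $(\bar x,\bar u)\in\mathrm{gph}\,S$ is the mapping $D^*S(\bar x|\bar u):\mathbb{R}^m\rightrightarrows\mathbb{R}^n$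 with $x^*\in D^*S(\bar x|\bar u)(u^*)\iff (x^*,-u^*)\in N_{\mathrm{gph}\,S}(\bar x,\bar u)$. The projectional coderivative $D^*_XS(\bar x|\bar u):\mathbb{R}^m\rightrightarrows\mathbb{R}^n$ is given by $$t^*\in D^*_XS(\bar x|\bar u)(u^*)\iff (t^*,-u^*)\in\limsup_{(x,u)\to(\bar x,\bar u),\ (x,u)\in \mathrm{gph}\,S|_X}\mathrm{proj}_{T_X(x)\times\mathbb{R}^m}N_{\mathrm{gph}\,S|_X}(x,u).$$ The outer norm of a positively homogeneous mapping $G$ is $|G|^+=\sup_{y\in\mathbb{B}}\sup_{v\in G(y)}\|v\|\in[0,\infty]$. Let $\bar x\in X$ and $\bar u\in S(\bar x)$. $S$ has the *Lipschitz-like property relative to $X$ at $\bar x$ for $\bar u$* if $\mathrm{gph}\,S$ is locally closed at $(\bar x,\bar u)$ and there are neighborhoods $V$ of $\bar x$ and $W$ of $\bar u$ and $\kappa\ge 0$ with $$S(x')\cap W\subseteq S(x)+\kappa\|x'-x\|\mathbb{B}\qquad\forall x,x'\in X\cap V .\tag{1}$$ The relative graphical modulus $\mathrm{lip}_XS(\bar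 x|\bar u)\in[0,\infty]$ is the infimum of all $\kappa\ge0$ for which (1) holds with some neighborhoods $V,W$ ($\inf\emptyset=+\infty$). The set $X$ is a $d$-dimensional smooth manifold around $\bar x\in X$ (where $0\le d\le n$) if there are an open neighborhood $O$ of $\bar x$ and a $\mathcal{C}^1$ mapping $F:O\to\mathbb{R}^{n-d}$ with $X\cap O=\{x\in O\mid F(x)=0\}$ and $\nabla F(\bar x)$ of full rank $n-d$. **Theorem.** Let $S:\mathbb{R}^n\rightrightarrows\mathbb{R}^m$, let $X\subseteq\mathbb{R}^n$ be a smooth manifold (of some dimension $d$) around $\bar x\in X$, let $\bar u\in S(\bar x)$, and suppose that $\mathrm{gph}\,S$ is locally closed at $(\bar x,\bar u)$. Then the following are equivalent: (a) $S$ has the Lipschitz-like property relative to $X$ at $\bar x$ for $\bar u$; (b) $\mathrm{proj}_{T_X(\bar x)}D^*S|_X(\bar x|\bar u)(0)=\{0\}$; (c) $|\mathrm{proj}_{T_X(\bar x)}D^*S|_X(\bar x|\bar u)|^+<+\infty$, where $\mathrm{proj}_{T_X(\bar x)}D^*S|_X(\bar x|\bar u)$ is the mapping $u^*\mapsto\mathrm{proj}_{T_X(\bar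 x)}\bigl(D^*S|_X(\bar x|\bar u)(u^*)\bigr)$; (d) $D^*S|_X(\bar x|\bar u)(0)\cap T_X(\bar x)=\{0\}$; (e) $D^*S|_X(\bar x|\bar u)(0)=N_X(\bar x)$; (f) $D^*_XS(\bar x|\bar u)(0)=\{0\}$. Furthermore (whether or not these properties hold, both sides being $+\infty$ if they do not), $$\mathrm{lip}_XS(\bar x|\bar u)=\bigl|\mathrm{proj}_{T_X(\bar x)}D^*S|_X(\bar x|\bar u)\bigr|^+ .$$ -/

import Mathlib

open Filter Topology
open scoped Pointwise ENNReal NNReal RealInnerProductSpace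

noncomputable section

namespace VarAnal

/-- The sequential (Painlevé–Kuratowski) outer limit of `Φ z` as `z → z₀` within `C`: all limits of
sequences `v k ∈ Φ (z k)` with `z k ∈ C`, `z k → z₀`. -/
def outerLimit {Z H : Type*} [TopologicalSpace Z] [TopologicalSpace H]
    (Φ : Z → Set H) (C : Set Z) (z₀ : Z) : Set H :=
  {v | ∃ (z : ℕ → Z) (w : ℕ → H), (∀ k, z k ∈ C) ∧ Tendsto z atTop (𝓝 z₀) ∧
    (∀ k, w k ∈ Φ (z k)) ∧ Tendsto w atTop (𝓝 v)}

section InnerProduct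

variable {H : Type*} [NormedAddCommGroup H] [InnerProductSpace ℝ H]

/-- The tangent (contingent) cone `T_C(x) = limsup_{t ↘ 0} (C - x) / t`, empty for `x ∉ C`. -/
def tangentCone (C : Set H) (x : H) : Set H :=
  {w | x ∈ C ∧ w ∈ outerLimit (fun t : ℝ => (fun y : H => t⁻¹ • (y - x)) '' C) (Set.Ioi 0) 0}

/-- The regular (Fréchet) normal cone, empty for `x ∉ C`: the `limsup` of the quotients
`⟪v, x' - x⟫ / ‖x' - x‖` as `x' → x` within `C`, `x' ≠ x`, is at most `0`. -/
def regularNormalCone (C : Set H) (x : H) : Set H :=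
  {v | x ∈ C ∧ ∀ ε : ℝ, 0 < ε → ∀ᶠ x' in 𝓝[C] x, ⟪v, x' - x⟫ ≤ ε * ‖x' - x‖}

/-- The limiting (Mordukhovich) normal cone, empty for `x ∉ C`. -/
def normalCone (C : Set H) (x : H) : Set H :=
  {v | x ∈ C ∧ v ∈ outerLimit (regularNormalCone C) C x}

/-- The projection of the set `A` onto the set `C`: all nearest points in `C` to points of `A`. -/
def projSet (C A : Set H) : Set H :=
  {y | y ∈ C ∧ ∃ x ∈ A, dist x y = Metric.infDist x C}

/-- `C` is locally closed at `x`: `C ∩ U` is closed for some closed neighbourhood `U` of `x`. -/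
def LocallyClosedAt (C : Set H) (x : H) : Prop :=
  ∃ U ∈ 𝓝 x, IsClosed U ∧ IsClosed (C ∩ U)

end InnerProduct

section SetValued

variable {E F : Type*} [NormedAddCommGroup E] [InnerProductSpace ℝ E]
  [NormedAddCommGroup F] [InnerProductSpace ℝ F]

/-- The graph of a set-valued mapping, in the product with its Euclidean (`ℓ²`) structure. -/
def gph (S : E → Set F) : Set (WithLp 2 (E × F)) :=
  {p | p.snd ∈ S p.fst}

/-- The restricted mapping `S|_X`: equal to `S x` for `x ∈ X` and empty for `x ∉ X`. -/
def restrictTo (S : E → Set F) (X : Set E) : E → Set F :=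
  fun x => {u | x ∈ X ∧ u ∈ S x}

/-- The (limiting) coderivative `D*S(x|u) : F ⇉ E`. -/
def coderivative (S : E → Set F) (x : E) (u : F) : F → Set E :=
  fun us => {xs | WithLp.toLp 2 (xs, -us) ∈ normalCone (gph S) (WithLp.toLp 2 (x, u))}

/-- The projectional coderivative `D*_X S(x|u) : F ⇉ E`. -/
def projCoderivative (X : Set E) (S : E → Set F) (x : E) (u : F) : F → Set E :=
  fun us => {ts | WithLp.toLp 2 (ts, -us) ∈
    outerLimit
      (fun p : WithLp 2 (E × F) =>
        projSet {q : WithLp 2 (E × F) | q.fst ∈ tangentCone X p.fst}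
          (normalCone (gph (restrictTo S X)) p))
      (gph (restrictTo S X)) (WithLp.toLp 2 (x, u))}

/-- The outer norm `|G|⁺ = sup_{‖y‖ ≤ 1} sup_{v ∈ G y} ‖v‖ ∈ [0, ∞]`. -/
def outerNorm (G : F → Set E) : ℝ≥0∞ :=
  ⨆ y ∈ Metric.closedBall (0 : F) 1, ⨆ v ∈ G y, ‖v‖ₑ

/-- For some neighbourhoods `V` of `x₀` and `W` of `u₀`, the inclusion
`S(x') ∩ W ⊆ S(x) + κ ‖x' - x‖ 𝔹` holds for all `x, x' ∈ X ∩ V`. -/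
def LipschitzLikeEstimate (X : Set E) (S : E → Set F) (x₀ : E) (u₀ : F) (κ : ℝ≥0) : Prop :=
  ∃ V ∈ 𝓝 x₀, ∃ W ∈ 𝓝 u₀, ∀ x ∈ X ∩ V, ∀ x' ∈ X ∩ V,
    S x' ∩ W ⊆ S x + ((κ : ℝ) * ‖x' - x‖) • Metric.closedBall (0 : F) 1

/-- The Lipschitz-like property of `S` relative to `X` at `x₀` for `u₀`. -/
def LipschitzLike (X : Set E) (S : E → Set F) (x₀ : E) (u₀ : F) : Prop :=
  LocallyClosedAt (gph S) (WithLp.toLp 2 (x₀, u₀)) ∧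
    ∃ κ : ℝ≥0, LipschitzLikeEstimate X S x₀ u₀ κ

/-- The graphical modulus `lip_X S(x₀|u₀) ∈ [0, ∞]`: the infimum of all admissible constants, with
value `∞` if there are none. -/
def lipModulus (X : Set E) (S : E → Set F) (x₀ : E) (u₀ : F) : ℝ≥0∞ :=
  ⨅ (κ : ℝ≥0) (_ : LipschitzLikeEstimate X S x₀ u₀ κ), (κ : ℝ≥0∞)

end SetValued

/-- `X ⊆ ℝⁿ` is a `d`-dimensional smooth (`C¹`) manifold around `x₀ ∈ X`: within some open
neighbourhood `O` of `x₀` it is the solution set of `Φ(x) = 0`, where `Φ : O → ℝⁿ⁻ᵈ` is `C¹`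
and its derivative at `x₀` has full rank `n - d`. -/
def IsSmoothManifoldAround {n : ℕ} (d : ℕ) (X : Set (EuclideanSpace ℝ (Fin n)))
    (x₀ : EuclideanSpace ℝ (Fin n)) : Prop :=
  d ≤ n ∧ x₀ ∈ X ∧
    ∃ (O : Set (EuclideanSpace ℝ (Fin n)))
      (Φ : EuclideanSpace ℝ (Fin n) → EuclideanSpace ℝ (Fin (n - d))),
      IsOpen O ∧ x₀ ∈ O ∧ ContDiffOn ℝ 1 Φ O ∧ X ∩ O = {x ∈ O | Φ x = 0} ∧
        Function.Surjective (fderiv ℝ Φ x₀)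

end VarAnal

end

namespace VarAnal

/-! Near `xbar` the set `X` is the zero set of a C¹ submersion `Φ`. With `L` its derivative at
`xbar`, the tangent cone is `ker L` and the normal cone is the range of the adjoint `L*`. As `Φ`
vanishes on `X`, adding `(L* l, 0)` to a normal of the graph of `S|_X` gives a normal again. Nearest
points in `ker L` differ from the original by an element of range `L*`, so projecting a coderivative
onto the tangent cone merely intersects it with `ker L` (`projSet_coderivative_eq`,
`projCoderivative_eq`). Hence (b), (d), (f) are one statement, and (e) follows from `H = ker L ⊕
range L*`.

The rest is the modulus formula `lipModulus_eq`. Upper bound on the outer norm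
(`norm_le_of_lipschitzLikeEstimate`): test normals along curves in `X` lifted to the graph by the
Lipschitz estimate. Converse (`exists_regularNormal_of_not_mem`,
`lipschitzLikeEstimate_of_norm_lt`): where the estimate fails, minimizing a penalized distance over
the graph produces a normal with unit first component and small second component; in the limit its
first component is tangent to `X`, contradicting the norm bound. Homogeneity and compactness make
finiteness of the outer norm equivalent to triviality at `0` (`outerNorm_lt_top_iff`). -/

/-- The outer limit is a section of the closure of the graph. -/
theorem mem_outerLimit_iff {Z H : Type*} [TopologicalSpace Z] [TopologicalSpace H]
    [FirstCountableTopology Z] [FirstCountableTopology H]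
    {Φ : Z → Set H} {C : Set Z} {z₀ : Z} {v : H} :
    v ∈ outerLimit Φ C z₀ ↔ ∃ᶠ q : Z × H in 𝓝 (z₀, v), q.1 ∈ C ∧ q.2 ∈ Φ q.1 := by
  change _ ↔ ∃ᶠ q in 𝓝 (z₀, v), q ∈ {q : Z × H | q.1 ∈ C ∧ q.2 ∈ Φ q.1}
  rw [← mem_closure_iff_frequently, mem_closure_iff_seq_limit]
  constructor
  · rintro ⟨z, w, hz, hz₀, hw, hv⟩
    exact ⟨fun k => (z k, w k), fun k => ⟨hz k, hw k⟩, hz₀.prodMk_nhds hv⟩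
  · rintro ⟨q, hq, hlim⟩
    exact ⟨fun k => (q k).1, fun k => (q k).2, fun k => (hq k).1,
      (continuous_fst.tendsto _).comp hlim, fun k => (hq k).2,
      (continuous_snd.tendsto _).comp hlim⟩

/-- Taking outer limits is idempotent. -/
theorem mem_of_frequently_mem_outerLimit {Z H : Type*} [TopologicalSpace Z] [TopologicalSpace H]
    [FirstCountableTopology Z] [FirstCountableTopology H]
    {Φ : Z → Set H} {C : Set Z} {z₀ : Z} {v : H}
    (h : ∃ᶠ q : Z × H in 𝓝 (z₀, v), q.2 ∈ outerLimit Φ C q.1) :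
    v ∈ outerLimit Φ C z₀ := by
  simp only [mem_outerLimit_iff] at h ⊢
  change ∃ᶠ q in 𝓝 (z₀, v), q ∈ {q : Z × H | q.1 ∈ C ∧ q.2 ∈ Φ q.1}
  rw [← mem_closure_iff_frequently, ← closure_closure, mem_closure_iff_frequently]
  exact h.mono fun q hq => mem_closure_iff_frequently.2 hq

/-! ### Normal cones under C¹ equality constraints. -/

section Cones

variable {H : Type*} [NormedAddCommGroup H] [InnerProductSpace ℝ H]

theorem mem_normalCone_iff {C : Set H} {x v : H} :
    v ∈ normalCone C x ↔ x ∈ C ∧ ∃ᶠ q : H × H in 𝓝 (x, v), q.2 ∈ regularNormalCone C q.1 := by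
  refine and_congr_right fun _ => mem_outerLimit_iff.trans ?_
  refine frequently_congr (Eventually.of_forall fun q => ?_)
  exact ⟨fun h => h.2, fun h => ⟨h.1, h⟩⟩

theorem mem_normalCone_of_frequently {C : Set H} {x v : H} (hx : x ∈ C)
    (h : ∃ᶠ q : H × H in 𝓝 (x, v), q.2 ∈ normalCone C q.1) : v ∈ normalCone C x :=
  ⟨hx, mem_of_frequently_mem_outerLimit (h.mono fun _ hq => hq.2)⟩

theorem zero_mem_normalCone {C : Set H} {x : H} (hx : x ∈ C) : (0 : H) ∈ normalCone C x := by
  refine ⟨hx, fun _ => x, fun _ => 0, fun _ => hx, tendsto_const_nhds, fun _ => ⟨hx, ?_⟩,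
    tendsto_const_nhds⟩
  intro ε hε
  exact Eventually.of_forall fun y => by simpa using by positivity

theorem smul_mem_regularNormalCone {C : Set H} {x v : H} (hv : v ∈ regularNormalCone C x)
    {t : ℝ} (ht : 0 < t) : t • v ∈ regularNormalCone C x := by
  refine ⟨hv.1, fun ε hε => ?_⟩
  filter_upwards [hv.2 (ε / t) (by positivity)] with y hy
  rw [real_inner_smul_left]
  calc t * ⟪v, y - x⟫ ≤ t * (ε / t * ‖y - x‖) := by gcongr
    _ = ε * ‖y - x‖ := by field_simp

theorem smul_mem_normalCone {C : Set H} {x v : H} (hv : v ∈ normalCone C x)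
    {t : ℝ} (ht : 0 < t) : t • v ∈ normalCone C x := by
  obtain ⟨hx, z, w, hz, hzx, hw, hwv⟩ := hv
  exact ⟨hx, z, fun k => t • w k, hz, hzx, fun k => smul_mem_regularNormalCone (hw k) ht,
    hwv.const_smul t⟩

variable {Y : Type*} [NormedAddCommGroup Y] [InnerProductSpace ℝ Y]

section Adjoint

variable [CompleteSpace H] [CompleteSpace Y]

/-- For `y ∈ C` both values of `Φ` vanish, so `L (y - x)` is `o(‖y - x‖)` and the added term does
not affect the defining inequality. -/
theorem add_adjoint_mem_regularNormalCone {C : Set H} {Φ : H → Y} {L : H →L[ℝ] Y} {x v : H}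
    (hΦ : HasFDerivAt Φ L x) (h0 : ∀ᶠ y in 𝓝 x, y ∈ C → Φ y = 0)
    (hv : v ∈ regularNormalCone C x) (l : Y) :
    v + ContinuousLinearMap.adjoint L l ∈ regularNormalCone C x := by
  refine ⟨hv.1, fun ε hε => ?_⟩
  have hx0 : Φ x = 0 := h0.self_of_nhds hv.1
  have hl : 0 < ε / (2 * (‖l‖ + 1)) := by positivity
  filter_upwards [hv.2 (ε / 2) (by positivity), nhdsWithin_le_nhds h0,
    nhdsWithin_le_nhds (hΦ.isLittleO.def hl), self_mem_nhdsWithin] with y h1 h2 h3 hy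
  rw [h2 hy, hx0, sub_self, zero_sub, norm_neg] at h3
  rw [inner_add_left, ContinuousLinearMap.adjoint_inner_left]
  have h4 : ⟪l, L (y - x)⟫ ≤ ε / 2 * ‖y - x‖ :=
    calc ⟪l, L (y - x)⟫ ≤ ‖l‖ * ‖L (y - x)‖ := real_inner_le_norm _ _
      _ ≤ (‖l‖ + 1) * (ε / (2 * (‖l‖ + 1)) * ‖y - x‖) := by gcongr; linarith
      _ = ε / 2 * ‖y - x‖ := by field_simp
  linarith

/-- The shift by the adjoint of the derivative at the moving base point depends continuously on that
point, so the regular case passes to the limit. -/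
theorem add_adjoint_mem_normalCone {C : Set H} {Φ : H → Y} {x v : H}
    (hΦ : ContDiffAt ℝ 1 Φ x) (h0 : ∀ᶠ y in 𝓝 x, y ∈ C → Φ y = 0)
    (hv : v ∈ normalCone C x) (l : Y) :
    v + ContinuousLinearMap.adjoint (fderiv ℝ Φ x) l ∈ normalCone C x := by
  rw [mem_normalCone_iff] at hv ⊢
  refine ⟨hv.1, ?_⟩
  have hc : ContinuousAt (fderiv ℝ Φ) x :=
    (hΦ.fderiv_right (m := 0) (by norm_num)).continuousAt
  have ht : Tendsto (fun q : H × H => (q.1, q.2 + ContinuousLinearMap.adjoint (fderiv ℝ Φ q.1) l))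
      (𝓝 (x, v)) (𝓝 (x, v + ContinuousLinearMap.adjoint (fderiv ℝ Φ x) l)) := by
    have h1 : ContinuousAt (fun q : H × H => fderiv ℝ Φ q.1) (x, v) :=
      ContinuousAt.comp (f := Prod.fst) hc continuousAt_fst
    have h2 : ContinuousAt
        (fun q : H × H => ContinuousLinearMap.adjoint (fderiv ℝ Φ q.1) l) (x, v) :=
      ((ContinuousLinearMap.adjoint (𝕜 := ℝ) (E := H) (F := Y)).continuous.continuousAt.comp
        h1).clm_apply continuousAt_const
    exact continuousAt_fst.prodMk (continuousAt_snd.add h2)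
  have hev : ∀ᶠ q : H × H in 𝓝 (x, v),
      HasFDerivAt Φ (fderiv ℝ Φ q.1) q.1 ∧ ∀ᶠ y in 𝓝 q.1, y ∈ C → Φ y = 0 := by
    have : ∀ᶠ z in 𝓝 x,
        HasFDerivAt Φ (fderiv ℝ Φ z) z ∧ ∀ᶠ y in 𝓝 z, y ∈ C → Φ y = 0 := by
      filter_upwards [hΦ.eventually (by simp), h0.eventually_nhds] with z hz hz'
      exact ⟨(hz.differentiableAt (by simp)).hasFDerivAt, hz'⟩
    exact (continuous_fst.tendsto (x, v)).eventually this
  exact ht.frequently ((hv.2.and_eventually hev).mono fun q hq =>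
    add_adjoint_mem_regularNormalCone hq.2.1 hq.2.2 hq.1 l)

end Adjoint

/-! ### Level sets of submersions and their tangent cones. -/

/-- Around `x ∈ C`, the set `C` is the zero set of the `C¹` submersion `Φ`. -/
structure IsRegularLevelSetAt (Φ : H → Y) (C : Set H) (x : H) : Prop where
  mem : x ∈ C
  contDiffAt : ContDiffAt ℝ 1 Φ x
  eventually_iff : ∀ᶠ y in 𝓝 x, y ∈ C ↔ Φ y = 0
  surjective : Function.Surjective (fderiv ℝ Φ x)

namespace IsRegularLevelSetAt

variable {Φ : H → Y} {C : Set H} {x : H}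

theorem eq_zero (h : IsRegularLevelSetAt Φ C x) : Φ x = 0 :=
  h.eventually_iff.self_of_nhds.1 h.mem

theorem eventually_eq_zero (h : IsRegularLevelSetAt Φ C x) : ∀ᶠ y in 𝓝 x, y ∈ C → Φ y = 0 :=
  h.eventually_iff.mono fun _ hy => hy.1

theorem continuousAt_fderiv (h : IsRegularLevelSetAt Φ C x) : ContinuousAt (fderiv ℝ Φ) x :=
  (h.contDiffAt.fderiv_right (m := 0) (by norm_num)).continuousAt

/-- Surjectivity is an open condition: a right inverse of the derivative at `x`, composed with
nearby derivatives, still gives a unit. -/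
theorem eventually_nhds [FiniteDimensional ℝ Y] (h : IsRegularLevelSetAt Φ C x) :
    ∀ᶠ y in 𝓝 x, y ∈ C → IsRegularLevelSetAt Φ C y := by
  obtain ⟨R, hR⟩ := (fderiv ℝ Φ x).toLinearMap.exists_rightInverse_of_surjective
    (LinearMap.range_eq_top.2 h.surjective)
  let R' : Y →L[ℝ] H := LinearMap.toContinuousLinearMap R
  have hu : IsUnit ((fderiv ℝ Φ x).comp R') := by
    have : (fderiv ℝ Φ x).comp R' = 1 := by
      ext y
      exact LinearMap.congr_fun hR y
    rw [this]
    exact isUnit_one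
  have hcont : ContinuousAt (fun y => (fderiv ℝ Φ y).comp R') x :=
    h.continuousAt_fderiv.clm_comp continuousAt_const
  filter_upwards [h.contDiffAt.eventually (by simp), h.eventually_iff.eventually_nhds,
    hcont.eventually (Units.isOpen.mem_nhds hu)] with y h1 h2 h3 hy
  refine ⟨hy, h1, h2, fun z => ?_⟩
  obtain ⟨U, hU⟩ := h3
  refine ⟨R' ((↑U⁻¹ : Y →L[ℝ] Y) z), ?_⟩
  have : ((U : Y →L[ℝ] Y) * (↑U⁻¹ : Y →L[ℝ] Y)) z = z := by rw [Units.mul_inv]; rfl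
  rw [hU] at this
  exact this

/-- Tangent directions at `x` can be followed, up to a relative error `ε`, from all points of the
level set close to `x`. -/
theorem eventually_exists_mem_near [CompleteSpace H] [CompleteSpace Y]
    (h : IsRegularLevelSetAt Φ C x) {w : H} (hw : fderiv ℝ Φ x w = 0) {ε : ℝ} (hε : 0 < ε) :
    ∀ᶠ q : H × ℝ in 𝓝 (x, 0), q.1 ∈ C → 0 < q.2 →
      ∃ y ∈ C, ‖y - (q.1 + q.2 • w)‖ ≤ ε * q.2 := by
  have hr : (fderiv ℝ Φ x).range = ⊤ := LinearMap.range_eq_top.2 h.surjective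
  set R := (fderiv ℝ Φ x).nonlinearRightInverseOfSurjective hr with hR
  have hRpos : 0 < R.nnnorm :=
    (fderiv ℝ Φ x).nonlinearRightInverseOfSurjective_nnnorm_pos hr
  obtain ⟨M, hM, hMR⟩ : ∃ M : ℝ, 0 < M ∧ M = (R.nnnorm : ℝ)⁻¹ :=
    ⟨_, inv_pos.2 (by exact_mod_cast hRpos), rfl⟩
  -- A step `t • w` changes `Φ` by at most `c * t * ‖w‖`, while `Φ` maps the ball of radius `ε * t`
  -- onto one of radius `(M - c) * ε * t`; this `c` balances the two.
  obtain ⟨c, hc, hcM⟩ : ∃ c : ℝ≥0, 0 < c ∧ (c : ℝ) * ‖w‖ ≤ (M - c) * ε := by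
    have h0 : 0 < M * ε / (‖w‖ + ε) := by positivity
    refine ⟨(M * ε / (‖w‖ + ε)).toNNReal, Real.toNNReal_pos.2 h0, le_of_eq ?_⟩
    have : ‖w‖ + ε ≠ 0 := by positivity
    rw [Real.coe_toNNReal _ h0.le]
    field_simp
    ring
  obtain ⟨s, hs, hlin⟩ := (h.contDiffAt.hasStrictFDerivAt (by simp)).approximates_deriv_on_nhds
    (Or.inr hc)
  obtain ⟨r, hr, hrs⟩ := Metric.mem_nhds_iff.1 (inter_mem hs h.eventually_iff)
  have hlt : ∀ᶠ q : H × ℝ in 𝓝 (x, 0), dist q.1 x + |q.2| * (‖w‖ + ε) < r := by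
    have hcont : Continuous fun q : H × ℝ => dist q.1 x + |q.2| * (‖w‖ + ε) := by fun_prop
    exact (hcont.tendsto (x, 0)).eventually (gt_mem_nhds (by simpa using hr))
  filter_upwards [hlt] with q hq hqC hq2
  rw [abs_of_pos hq2] at hq
  have hnorm : ‖q.2 • w‖ = q.2 * ‖w‖ := by rw [norm_smul, Real.norm_of_nonneg hq2.le]
  have hball : ∀ y, ‖y - (q.1 + q.2 • w)‖ ≤ ε * q.2 → y ∈ Metric.ball x r := by
    intro y hy
    rw [Metric.mem_ball, dist_eq_norm]
    calc ‖y - x‖ = ‖(y - (q.1 + q.2 • w)) + q.2 • w + (q.1 - x)‖ := by congr 1; abel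
      _ ≤ ε * q.2 + q.2 * ‖w‖ + dist q.1 x := by
        rw [dist_eq_norm, ← hnorm]
        exact (norm_add_le _ _).trans (by gcongr; exact (norm_add_le _ _).trans (by gcongr))
      _ < r := by linarith
  have hq1 : q.1 ∈ Metric.ball x r := by
    rw [Metric.mem_ball]
    have : 0 ≤ q.2 * (‖w‖ + ε) := by positivity
    linarith
  have hsurj := hlin.surjOn_closedBall_of_nonlinearRightInverse R (b := q.1 + q.2 • w)
    (ε := ε * q.2) (by positivity) fun y hy => (hrs (hball y (by
      rwa [Metric.mem_closedBall, dist_eq_norm] at hy))).1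
  have hb : q.1 + q.2 • w ∈ Metric.ball x r := hball _ (by simpa using by positivity)
  have h0 : (0 : Y) ∈ Metric.closedBall (Φ (q.1 + q.2 • w))
      (((R.nnnorm : ℝ)⁻¹ - c) * (ε * q.2)) := by
    have h1 := hlin (q.1 + q.2 • w) (hrs hb).1 q.1 (hrs hq1).1
    rw [(hrs hq1).2.1 hqC, add_sub_cancel_left, map_smul, hw, smul_zero, sub_zero, sub_zero,
      hnorm] at h1
    rw [Metric.mem_closedBall, dist_comm, dist_zero_right, ← hMR]
    nlinarith
  obtain ⟨y, hy, hy0⟩ := hsurj h0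
  rw [Metric.mem_closedBall, dist_eq_norm] at hy
  exact ⟨y, (hrs (hball y hy)).2.2 hy0, hy⟩

theorem tangentCone_eq_ker [CompleteSpace H] [CompleteSpace Y] (h : IsRegularLevelSetAt Φ C x) :
    tangentCone C x = ((fderiv ℝ Φ x).ker : Set H) := by
  ext w
  constructor
  · rintro ⟨_, t, v, ht, ht0, hv, hvw⟩
    choose y hyC hy using hv
    have hd : Tendsto (fun k => y k - x) atTop (𝓝 0) := by
      have : ∀ k, y k - x = t k • v k := fun k => by
        rw [← hy k, smul_inv_smul₀ (ne_of_gt (ht k))]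
      simp only [this]
      simpa using ht0.smul hvw
    have hyx : Tendsto y atTop (𝓝 x) := by simpa using hd.add_const x
    have hder := (h.contDiffAt.differentiableAt (by simp)).hasFDerivAt
    have hlim := (hasFDerivWithinAt_univ.2 hder).lim (c := fun k => (t k)⁻¹) hd
      (Eventually.of_forall fun _ => Set.mem_univ _) (hvw.congr fun k => (hy k).symm)
    refine tendsto_nhds_unique hlim (tendsto_const_nhds.congr' ?_)
    filter_upwards [hyx.eventually h.eventually_eq_zero] with k hk
    simp [hk (hyC k), h.eq_zero]
  · intro hw
    refine ⟨h.mem, mem_outerLimit_iff.2 ?_⟩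
    rw [Metric.nhds_basis_ball.frequently_iff]
    intro ε hε
    have h1 : ∀ᶠ t : ℝ in 𝓝[>] 0, 0 < t ∧ t < ε ∧ (x ∈ C → 0 < t →
        ∃ y ∈ C, ‖y - (x + t • w)‖ ≤ ε / 2 * t) := by
      have hcont : Tendsto (fun t : ℝ => (x, t)) (𝓝[>] 0) (𝓝 (x, 0)) :=
        ((by fun_prop : Continuous fun t : ℝ => (x, t)).tendsto 0).mono_left nhdsWithin_le_nhds
      filter_upwards [self_mem_nhdsWithin, nhdsWithin_le_nhds (gt_mem_nhds hε),
        hcont.eventually (h.eventually_exists_mem_near hw (half_pos hε))] with t a b c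
      exact ⟨a, b, c⟩
    obtain ⟨t, ht, htε, hy⟩ := h1.exists
    obtain ⟨y, hyC, hy⟩ := hy h.mem ht
    refine ⟨(t, t⁻¹ • (y - x)), ?_, ht, y, hyC, rfl⟩
    rw [Metric.mem_ball, Prod.dist_eq, max_lt_iff]
    refine ⟨by simpa [abs_of_pos ht] using htε, ?_⟩
    have : t⁻¹ • (y - x) - w = t⁻¹ • (y - (x + t • w)) := by
      rw [← sub_sub, smul_sub t⁻¹ (y - x), inv_smul_smul₀ ht.ne']
    rw [dist_eq_norm, this, norm_smul, Real.norm_of_nonneg (by positivity)]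
    calc t⁻¹ * ‖y - (x + t • w)‖ ≤ t⁻¹ * (ε / 2 * t) := by gcongr
      _ = ε / 2 := by field_simp
      _ < ε := by linarith

end IsRegularLevelSetAt

/-- Projecting onto the kernel of `L` a set which is invariant under the range of the adjoint. -/
theorem projSet_ker_eq [FiniteDimensional ℝ H] [FiniteDimensional ℝ Y] (L : H →L[ℝ] Y) {A : Set H}
    (hA : ∀ v ∈ A, ∀ l, v + ContinuousLinearMap.adjoint L l ∈ A) :
    projSet (L.ker : Set H) A = A ∩ L.ker := by
  ext y
  constructor
  · rintro ⟨hy, v, hv, hd⟩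
    refine ⟨?_, hy⟩
    rw [dist_eq_norm, Metric.infDist_eq_iInf] at hd
    simp only [dist_eq_norm] at hd
    -- The residual is orthogonal to `ker L`, hence in the range of the adjoint, and the invariance
    -- of `A` puts `y` itself in `A`.
    have h1 : v - y ∈ (L.ker)ᗮ := by
      rw [Submodule.mem_orthogonal']
      exact (Submodule.norm_eq_iInf_iff_inner_eq_zero L.ker hy).1 hd
    have h2 := LinearMap.orthogonal_ker (L : H →ₗ[ℝ] Y)
    rw [h2] at h1
    obtain ⟨l, hl⟩ := h1
    have h3 : ContinuousLinearMap.adjoint L l = v - y := hl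
    have := hA v hv (-l)
    rwa [map_neg, h3, neg_sub, add_sub_cancel] at this
  · rintro ⟨hyA, hy⟩
    exact ⟨hy, y, hyA, by rw [dist_self, Metric.infDist_zero_of_mem hy]⟩

theorem exists_sub_adjoint_mem_ker [FiniteDimensional ℝ H] [FiniteDimensional ℝ Y]
    (L : H →L[ℝ] Y) (v : H) : ∃ l, L (v - ContinuousLinearMap.adjoint L l) = 0 := by
  obtain ⟨y, hy, z, hz, rfl⟩ := (L.ker).exists_add_mem_mem_orthogonal v
  have h2 := LinearMap.orthogonal_ker (L : H →ₗ[ℝ] Y)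
  rw [h2] at hz
  obtain ⟨l, hl⟩ := hz
  have h3 : ContinuousLinearMap.adjoint L l = z := hl
  exact ⟨l, by rw [h3, add_sub_cancel_right]; exact hy⟩

end Cones

/-! ### Normals to a level set. -/

section LevelSet

variable {H Y : Type*} [NormedAddCommGroup H] [InnerProductSpace ℝ H]
  [NormedAddCommGroup Y] [InnerProductSpace ℝ Y] [FiniteDimensional ℝ H] [FiniteDimensional ℝ Y]
  {Φ : H → Y} {C : Set H} {x : H}

namespace IsRegularLevelSetAt

/-- One-sided linear growth bounds along the level set pass to tangent directions. -/
theorem eventually_inner_le (h : IsRegularLevelSetAt Φ C x) {w : H} (hw : fderiv ℝ Φ x w = 0)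
    {ε : ℝ} (hε : 0 < ε) :
    ∀ᶠ z in 𝓝 x, z ∈ C → ∀ (v : H) (c : ℝ), 0 ≤ c →
      (∀ᶠ y in 𝓝[C] z, ⟪v, y - z⟫ ≤ c * ‖y - z‖) → ⟪v, w⟫ ≤ c * (‖w‖ + ε) + ε * ‖v‖ := by
  have h1 := h.eventually_exists_mem_near hw hε
  -- Splitting the joint neighbourhood lets `t` be chosen after `z` and `v`, below the radius on
  -- which the growth bound holds; a single such `t` suffices.
  rw [nhds_prod_eq] at h1
  filter_upwards [h1.curry] with z hz hzC v c hc hv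
  rw [eventually_nhdsWithin_iff] at hv
  obtain ⟨r, hr, hball⟩ := Metric.eventually_nhds_iff.1 hv
  have h2 : ∀ᶠ t : ℝ in 𝓝[>] 0, 0 < t ∧ t * (‖w‖ + ε) < r ∧ (z ∈ C → 0 < t →
      ∃ y ∈ C, ‖y - (z + t • w)‖ ≤ ε * t) := by
    have hcont : Continuous fun t : ℝ => t * (‖w‖ + ε) := by fun_prop
    filter_upwards [self_mem_nhdsWithin, nhdsWithin_le_nhds hz, nhdsWithin_le_nhds
      ((hcont.tendsto 0).eventually (gt_mem_nhds (by simpa using hr)))] with t a b d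
    exact ⟨a, d, b⟩
  obtain ⟨t, ht, htr, hy⟩ := h2.exists
  obtain ⟨y, hyC, hy⟩ := hy hzC ht
  set e := y - (z + t • w) with he
  have hyz : y - z = t • w + e := by rw [he]; abel
  have hnorm : ‖y - z‖ ≤ t * (‖w‖ + ε) := by
    rw [hyz]
    refine (norm_add_le _ _).trans ?_
    rw [norm_smul, Real.norm_of_nonneg ht.le]
    linarith
  have h3 := hball (by rw [dist_eq_norm]; exact hnorm.trans_lt htr) hyC
  have h4 : ⟪v, y - z⟫ = t * ⟪v, w⟫ + ⟪v, e⟫ := by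
    rw [hyz, inner_add_right, real_inner_smul_right]
  have h5 : -(‖v‖ * (ε * t)) ≤ ⟪v, e⟫ := by
    have := (abs_le.1 (abs_real_inner_le_norm v e)).1
    have : ‖v‖ * ‖e‖ ≤ ‖v‖ * (ε * t) := by gcongr
    linarith
  have h6 : c * ‖y - z‖ ≤ c * (t * (‖w‖ + ε)) := by gcongr
  refine le_of_mul_le_mul_left ?_ ht
  linarith

/-- The vector is tested against itself as a tangent direction: letting `ε → 0` yields `⟪v, v⟫ ≤ 0`.
-/
theorem eq_zero_of_mem_normalCone_of_mem_ker (h : IsRegularLevelSetAt Φ C x) {v : H}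
    (hv : v ∈ normalCone C x) (hker : fderiv ℝ Φ x v = 0) : v = 0 := by
  have key : ∀ ε : ℝ, 0 < ε → ⟪v, v⟫ ≤ ε * (‖v‖ + ε) + ε * ‖v‖ := by
    intro ε hε
    have h1 : ∃ᶠ q : H × H in 𝓝 (x, v), ⟪q.2, v⟫ ≤ ε * (‖v‖ + ε) + ε * ‖q.2‖ := by
      refine ((mem_normalCone_iff.1 hv).2.and_eventually
        ((continuous_fst.tendsto (x, v)).eventually (h.eventually_inner_le hker hε))).mono ?_
      rintro q ⟨hq, hq'⟩
      exact hq' hq.1 q.2 ε hε.le (hq.2 ε hε)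
    exact (isClosed_le (f := fun q : H × H => ⟪q.2, v⟫)
      (g := fun q : H × H => ε * (‖v‖ + ε) + ε * ‖q.2‖) (by fun_prop)
      (by fun_prop)).mem_of_frequently_of_tendsto h1 tendsto_id
  have hcont : Continuous fun ε : ℝ => ε * (‖v‖ + ε) + ε * ‖v‖ := by fun_prop
  have hlim : Tendsto (fun ε : ℝ => ε * (‖v‖ + ε) + ε * ‖v‖) (𝓝[>] 0) (𝓝 0) := by
    simpa using (hcont.tendsto 0).mono_left nhdsWithin_le_nhds
  have hle := ge_of_tendsto hlim (eventually_mem_nhdsWithin.mono key)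
  exact inner_self_eq_zero.1 (le_antisymm hle real_inner_self_nonneg)

theorem mem_normalCone_iff_exists (h : IsRegularLevelSetAt Φ C x) {v : H} :
    v ∈ normalCone C x ↔ ∃ l, ContinuousLinearMap.adjoint (fderiv ℝ Φ x) l = v := by
  constructor
  · intro hv
    obtain ⟨l, hl⟩ := exists_sub_adjoint_mem_ker (fderiv ℝ Φ x) v
    have h1 := add_adjoint_mem_normalCone h.contDiffAt h.eventually_eq_zero hv (-l)
    rw [map_neg, ← sub_eq_add_neg] at h1
    exact ⟨l, (sub_eq_zero.1 (h.eq_zero_of_mem_normalCone_of_mem_ker h1 hl)).symm⟩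
  · rintro ⟨l, rfl⟩
    simpa using add_adjoint_mem_normalCone h.contDiffAt h.eventually_eq_zero
      (zero_mem_normalCone h.mem) l

end IsRegularLevelSetAt

end LevelSet

section Product

variable {E F : Type*} [NormedAddCommGroup E] [NormedAddCommGroup F]

theorem norm_toLp_le (a : E) (b : F) : ‖WithLp.toLp 2 (a, b)‖ ≤ ‖a‖ + ‖b‖ := by
  rw [WithLp.prod_norm_eq_of_L2]
  refine Real.sqrt_le_iff.2 ⟨by positivity, ?_⟩
  change ‖a‖ ^ 2 + ‖b‖ ^ 2 ≤ _
  nlinarith [norm_nonneg a, norm_nonneg b]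

theorem continuous_toLp_prodMk {Z : Type*} [TopologicalSpace Z] {f : Z → E} {g : Z → F}
    (hf : Continuous f) (hg : Continuous g) : Continuous fun z => WithLp.toLp 2 (f z, g z) :=
  (WithLp.prod_continuous_toLp 2 E F).comp (hf.prodMk hg)

theorem continuous_fst_withLp : Continuous fun p : WithLp 2 (E × F) => p.fst :=
  continuous_fst.comp (WithLp.prod_continuous_ofLp 2 E F)

theorem continuous_snd_withLp : Continuous fun p : WithLp 2 (E × F) => p.snd :=
  continuous_snd.comp (WithLp.prod_continuous_ofLp 2 E F)

variable {Y : Type*} [NormedAddCommGroup Y] [InnerProductSpace ℝ E] [InnerProductSpace ℝ Y]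
  {Φ : E → Y} {X : Set E} {S : E → Set F}

theorem eventually_gph_eq_zero {p : WithLp 2 (E × F)} (h : IsRegularLevelSetAt Φ X p.fst) :
    ∀ᶠ q in 𝓝 p, q ∈ gph (restrictTo S X) → Φ q.fst = 0 :=
  ((continuous_fst_withLp.tendsto p).eventually h.eventually_eq_zero).mono
    fun _ hq hqG => hq hqG.1

end Product

/-! ### Coderivatives of the restricted mapping. -/

section Graph

variable {E F Y : Type*} [NormedAddCommGroup E] [InnerProductSpace ℝ E]
  [NormedAddCommGroup F] [InnerProductSpace ℝ F] [NormedAddCommGroup Y] [InnerProductSpace ℝ Y]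
  {Φ : E → Y} {X : Set E} {S : E → Set F} {x : E} {u : F}

theorem contDiffAt_comp_fst {p : WithLp 2 (E × F)} (h : ContDiffAt ℝ 1 Φ p.fst) :
    ContDiffAt ℝ 1 (fun q : WithLp 2 (E × F) => Φ q.fst) p :=
  ContDiffAt.comp (g := Φ) (f := WithLp.fstL 2 ℝ E F) p h
    (WithLp.fstL 2 ℝ E F).contDiff.contDiffAt

theorem fderiv_comp_fst {p : WithLp 2 (E × F)} (h : ContDiffAt ℝ 1 Φ p.fst) :
    fderiv ℝ (fun q : WithLp 2 (E × F) => Φ q.fst) p =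
      (fderiv ℝ Φ p.fst).comp (WithLp.fstL 2 ℝ E F) :=
  (HasFDerivAt.comp (g := Φ) (f := WithLp.fstL 2 ℝ E F) p
    (h.differentiableAt (by simp)).hasFDerivAt (WithLp.fstL 2 ℝ E F).hasFDerivAt).fderiv

theorem smul_mem_coderivative {us : F} {xs : E} (hxs : xs ∈ coderivative S x u us) {t : ℝ}
    (ht : 0 < t) : t • xs ∈ coderivative S x u (t • us) := by
  have := smul_mem_normalCone (H := WithLp 2 (E × F)) hxs ht
  rw [← WithLp.toLp_smul, Prod.smul_mk, smul_neg] at this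
  exact this

variable [FiniteDimensional ℝ E] [FiniteDimensional ℝ Y]

/-- Tangential coderivative elements are bounded by any Lipschitz constant. -/
theorem norm_le_of_lipschitzLikeEstimate (h : IsRegularLevelSetAt Φ X x) {κ : ℝ≥0}
    (hκ : LipschitzLikeEstimate X S x u κ) {us : F} {xs : E}
    (hxs : xs ∈ coderivative (restrictTo S X) x u us) (hker : fderiv ℝ Φ x xs = 0) :
    ‖xs‖ ≤ κ * ‖us‖ := by
  obtain ⟨V, hV, W, hW, hVW⟩ := hκ
  have key : ∀ ε : ℝ, 0 < ε →
      ⟪xs, xs⟫ ≤ (ε * (1 + κ) + κ * ‖-us‖) * (‖xs‖ + ε) + ε * ‖xs‖ := by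
    intro ε hε
    have h1 : ∃ᶠ q : WithLp 2 (E × F) × WithLp 2 (E × F) in
        𝓝 (WithLp.toLp 2 (x, u), WithLp.toLp 2 (xs, -us)),
        ⟪q.2.fst, xs⟫ ≤ (ε * (1 + κ) + κ * ‖q.2.snd‖) * (‖xs‖ + ε) + ε * ‖q.2.fst‖ := by
      have hx : Tendsto (fun q : WithLp 2 (E × F) × WithLp 2 (E × F) => q.1.fst)
          (𝓝 (WithLp.toLp 2 (x, u), WithLp.toLp 2 (xs, -us))) (𝓝 x) :=
        (continuous_fst_withLp.comp continuous_fst).tendsto _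
      have hu : Tendsto (fun q : WithLp 2 (E × F) × WithLp 2 (E × F) => q.1.snd)
          (𝓝 (WithLp.toLp 2 (x, u), WithLp.toLp 2 (xs, -us))) (𝓝 u) :=
        (continuous_snd_withLp.comp continuous_fst).tendsto _
      refine ((mem_normalCone_iff.1 hxs).2.and_eventually
        ((hx.eventually (h.eventually_inner_le hker hε)).and
          ((hx.eventually (eventually_mem_nhds_iff.2 hV)).and (hu.eventually hW)))).mono ?_
      rintro ⟨p, q⟩ ⟨⟨hpG, hq⟩, hinner, hpV, hpW⟩
      refine hinner hpG.1 q.fst _ (by positivity) ?_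
      obtain ⟨r, hr, hball⟩ := Metric.eventually_nhds_iff.1 (eventually_nhdsWithin_iff.1 (hq ε hε))
      have hsmall : ∀ᶠ y in 𝓝 p.fst, (1 + κ) * ‖y - p.fst‖ < r := by
        have hcont : Continuous fun y : E => (1 + κ) * ‖y - p.fst‖ := by fun_prop
        exact (hcont.tendsto p.fst).eventually (gt_mem_nhds (by simpa using hr))
      filter_upwards [self_mem_nhdsWithin, nhdsWithin_le_nhds hpV, nhdsWithin_le_nhds hsmall]
        with y hyX hyV hyr
      -- The Lipschitz estimate lifts a nearby `y ∈ X` to a graph point, turning the normal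
      -- inequality on the graph into a growth bound along `X` for `q.fst` alone.
      obtain ⟨u', hu', e, he, hsum⟩ :=
        hVW y ⟨hyX, hyV⟩ p.fst ⟨hpG.1, mem_of_mem_nhds hpV⟩ ⟨hpG.2, hpW⟩
      obtain ⟨b, hb, rfl⟩ := he
      have hsum' : u' + (κ * ‖p.fst - y‖) • b = p.snd := hsum
      have hdist : ‖u' - p.snd‖ ≤ κ * ‖y - p.fst‖ := by
        rw [← hsum', sub_add_cancel_left, norm_neg, norm_smul, norm_sub_rev y,
          Real.norm_of_nonneg (by positivity)]
        exact mul_le_of_le_one_right (by positivity) (by simpa using hb)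
      have hsub : WithLp.toLp 2 (y, u') - p = WithLp.toLp 2 (y - p.fst, u' - p.snd) := rfl
      have hnorm : ‖WithLp.toLp 2 (y, u') - p‖ ≤ (1 + κ) * ‖y - p.fst‖ := by
        rw [hsub]
        refine (norm_toLp_le _ _).trans ?_
        linarith
      have h2 := hball (y := WithLp.toLp 2 (y, u')) (by
        rw [dist_eq_norm]; exact hnorm.trans_lt hyr) ⟨hyX, hu'⟩
      rw [WithLp.prod_inner_apply] at h2
      have h3 : ⟪q.fst, y - p.fst⟫ + ⟪q.snd, u' - p.snd⟫ ≤ ε * ‖WithLp.toLp 2 (y, u') - p‖ := h2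
      have h4 : ε * ‖WithLp.toLp 2 (y, u') - p‖ ≤ ε * ((1 + κ) * ‖y - p.fst‖) := by gcongr
      have h5 : -(‖q.snd‖ * (κ * ‖y - p.fst‖)) ≤ ⟪q.snd, u' - p.snd⟫ := by
        have := (abs_le.1 (abs_real_inner_le_norm q.snd (u' - p.snd))).1
        have : ‖q.snd‖ * ‖u' - p.snd‖ ≤ ‖q.snd‖ * (κ * ‖y - p.fst‖) := by gcongr
        linarith
      change ⟪q.fst, y - p.fst⟫ ≤ (ε * (1 + κ) + κ * ‖q.snd‖) * ‖y - p.fst‖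
      linarith
    have hc1 : Continuous fun q : WithLp 2 (E × F) × WithLp 2 (E × F) => q.2.fst :=
      continuous_fst_withLp.comp continuous_snd
    have hc2 : Continuous fun q : WithLp 2 (E × F) × WithLp 2 (E × F) => q.2.snd :=
      continuous_snd_withLp.comp continuous_snd
    exact (isClosed_le (f := fun q : WithLp 2 (E × F) × WithLp 2 (E × F) => ⟪q.2.fst, xs⟫)
      (g := fun q => (ε * (1 + κ) + κ * ‖q.2.snd‖) * (‖xs‖ + ε) + ε * ‖q.2.fst‖) (by fun_prop)
      (by fun_prop)).mem_of_frequently_of_tendsto h1 tendsto_id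
  have hcont : Continuous fun ε : ℝ =>
      (ε * (1 + κ) + κ * ‖-us‖) * (‖xs‖ + ε) + ε * ‖xs‖ := by fun_prop
  have hlim : Tendsto (fun ε : ℝ => (ε * (1 + κ) + κ * ‖-us‖) * (‖xs‖ + ε) + ε * ‖xs‖)
      (𝓝[>] 0) (𝓝 (κ * ‖us‖ * ‖xs‖)) := by
    simpa using (hcont.tendsto 0).mono_left nhdsWithin_le_nhds
  have hle := ge_of_tendsto hlim (eventually_mem_nhdsWithin.mono key)
  rw [real_inner_self_eq_norm_mul_norm] at hle
  rcases (norm_nonneg xs).eq_or_lt with h0 | h0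
  · rw [← h0]; positivity
  · exact le_of_mul_le_mul_right hle h0

variable [FiniteDimensional ℝ F]

theorem adjoint_comp_fstL (L : E →L[ℝ] Y) (l : Y) :
    ContinuousLinearMap.adjoint (L.comp (WithLp.fstL 2 ℝ E F)) l =
      WithLp.toLp 2 (ContinuousLinearMap.adjoint L l, 0) := by
  refine ext_inner_right ℝ fun q => ?_
  rw [ContinuousLinearMap.adjoint_inner_left, WithLp.prod_inner_apply]
  simp only [inner_zero_left, add_zero, ContinuousLinearMap.adjoint_inner_left]
  rfl

theorem add_adjoint_mem_coderivative (h : IsRegularLevelSetAt Φ X x) {us : F} {xs : E}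
    (hxs : xs ∈ coderivative (restrictTo S X) x u us) (l : Y) :
    xs + ContinuousLinearMap.adjoint (fderiv ℝ Φ x) l ∈
      coderivative (restrictTo S X) x u us := by
  have hc : ContDiffAt ℝ 1 Φ (WithLp.toLp 2 (x, u) : WithLp 2 (E × F)).fst := h.contDiffAt
  have h1 := add_adjoint_mem_normalCone (contDiffAt_comp_fst hc)
    (eventually_gph_eq_zero (S := S) (p := WithLp.toLp 2 (x, u)) h) hxs l
  rw [fderiv_comp_fst hc, adjoint_comp_fstL, ← WithLp.toLp_add, Prod.mk_add_mk, add_zero] at h1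
  exact h1

theorem projSet_coderivative_eq (h : IsRegularLevelSetAt Φ X x) (us : F) :
    projSet (tangentCone X x) (coderivative (restrictTo S X) x u us) =
      coderivative (restrictTo S X) x u us ∩ (fderiv ℝ Φ x).ker := by
  rw [h.tangentCone_eq_ker]
  exact projSet_ker_eq _ fun v hv l => add_adjoint_mem_coderivative h hv l

theorem projSet_normalCone_gph_eq {p : WithLp 2 (E × F)} (h : IsRegularLevelSetAt Φ X p.fst) :
    projSet {q : WithLp 2 (E × F) | q.fst ∈ tangentCone X p.fst}
        (normalCone (gph (restrictTo S X)) p) =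
      normalCone (gph (restrictTo S X)) p ∩ {q | fderiv ℝ Φ p.fst q.fst = 0} := by
  rw [h.tangentCone_eq_ker]
  refine projSet_ker_eq ((fderiv ℝ Φ p.fst).comp (WithLp.fstL 2 ℝ E F)) fun v hv l => ?_
  rw [← fderiv_comp_fst h.contDiffAt]
  exact add_adjoint_mem_normalCone (contDiffAt_comp_fst h.contDiffAt)
    (eventually_gph_eq_zero h) hv l

/-- Nearby points of `X` are regular too, so each projected normal cone is a kernel section; being
normal and lying in the kernel of the continuously varying derivative both survive limits.
Conversely, constant sequences suffice. -/
theorem projCoderivative_eq (h : IsRegularLevelSetAt Φ X x) (hu : u ∈ S x) (us : F) :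
    projCoderivative X S x u us =
      coderivative (restrictTo S X) x u us ∩ (fderiv ℝ Φ x).ker := by
  have hG : WithLp.toLp 2 (x, u) ∈ gph (restrictTo S X) := ⟨h.mem, hu⟩
  ext ts
  constructor
  · intro hts
    have h1 := mem_outerLimit_iff.1 (show WithLp.toLp 2 (ts, -us) ∈ outerLimit
      (fun p : WithLp 2 (E × F) => projSet {q : WithLp 2 (E × F) | q.fst ∈ tangentCone X p.fst}
        (normalCone (gph (restrictTo S X)) p)) _ _ from hts)
    have h2 : Tendsto (fun q : WithLp 2 (E × F) × WithLp 2 (E × F) => q.1.fst)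
        (𝓝 (WithLp.toLp 2 (x, u), WithLp.toLp 2 (ts, -us))) (𝓝 x) :=
      (continuous_fst_withLp.comp continuous_fst).tendsto _
    have h3 : ∃ᶠ q : WithLp 2 (E × F) × WithLp 2 (E × F) in
        𝓝 (WithLp.toLp 2 (x, u), WithLp.toLp 2 (ts, -us)),
        q.2 ∈ normalCone (gph (restrictTo S X)) q.1 ∧ fderiv ℝ Φ q.1.fst q.2.fst = 0 := by
      refine (h1.and_eventually (h2.eventually h.eventually_nhds)).mono ?_
      rintro q ⟨⟨hqG, hq⟩, hreg⟩
      rw [projSet_normalCone_gph_eq (hreg hqG.1)] at hq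
      exact hq
    refine ⟨mem_normalCone_of_frequently hG (h3.mono fun q hq => hq.1), ?_⟩
    have h4 : Tendsto (fun q : WithLp 2 (E × F) × WithLp 2 (E × F) => fderiv ℝ Φ q.1.fst q.2.fst)
        (𝓝 (WithLp.toLp 2 (x, u), WithLp.toLp 2 (ts, -us))) (𝓝 (fderiv ℝ Φ x ts)) :=
      (isBoundedBilinearMap_apply.continuous.tendsto (fderiv ℝ Φ x, ts)).comp
        ((h.continuousAt_fderiv.tendsto.comp h2).prodMk_nhds <|
          (continuous_fst_withLp.comp continuous_snd).tendsto _)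
    exact isClosed_singleton.mem_of_frequently_of_tendsto (h3.mono fun q hq => hq.2) h4
  · rintro ⟨hts, hker⟩
    refine ⟨fun _ => WithLp.toLp 2 (x, u), fun _ => WithLp.toLp 2 (ts, -us), fun _ => hG,
      tendsto_const_nhds, fun _ => ?_, tendsto_const_nhds⟩
    exact (projSet_normalCone_gph_eq (p := WithLp.toLp 2 (x, u)) h).ge ⟨hts, hker⟩

end Graph

/-! ### From coderivative bounds to the Lipschitz estimate. -/

section Fermat

variable {H : Type*} [NormedAddCommGroup H] [InnerProductSpace ℝ H]

/-- Fermat's rule: the negative gradient at a local minimizer over `C` is a regular normal. -/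
theorem mem_regularNormalCone_of_isLocalMinOn {C : Set H} {f : H → ℝ} {L : H →L[ℝ] ℝ} {p v : H}
    (hp : p ∈ C) (hmin : IsLocalMinOn f C p) (hf : HasFDerivAt f L p)
    (hv : ∀ z, L z = -⟪v, z⟫) : v ∈ regularNormalCone C p := by
  refine ⟨hp, fun ε hε => ?_⟩
  filter_upwards [hmin, nhdsWithin_le_nhds (hf.isLittleO.def hε)] with y h1 h2
  rw [hv, Real.norm_eq_abs] at h2
  have h3 : f p ≤ f y := h1
  linarith [(abs_le.1 h2).2]

/-- Used with `c = 0` for the norm away from `a`, and with `c = ε ^ 2` for a smoothed norm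
differentiable everywhere. -/
theorem hasFDerivAt_sqrt_norm_sub_sq_add (a y : H) (c : ℝ) (h : ‖y - a‖ ^ 2 + c ≠ 0) :
    HasFDerivAt (fun z => √(‖z - a‖ ^ 2 + c)) ((√(‖y - a‖ ^ 2 + c))⁻¹ • innerSL ℝ (y - a)) y := by
  have h1 := ((((hasFDerivAt_id y).sub_const a).norm_sq).add_const c).sqrt h
  refine h1.congr_fderiv ?_
  ext z
  simp
  ring

end Fermat

section Graph

variable {E F Y : Type*} [NormedAddCommGroup E] [InnerProductSpace ℝ E]
  [NormedAddCommGroup F] [InnerProductSpace ℝ F] [NormedAddCommGroup Y] [InnerProductSpace ℝ Y]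
  {Φ : E → Y} {X : Set E} {S : E → Set F} {x : E} {u : F}

theorem exists_isCompact_gph_inter_closedBall [FiniteDimensional ℝ E] [FiniteDimensional ℝ F]
    (h : IsRegularLevelSetAt Φ X x)
    (hS : LocallyClosedAt (gph S) (WithLp.toLp 2 (x, u))) :
    ∃ r > 0, IsCompact (gph (restrictTo S X) ∩ Metric.closedBall (WithLp.toLp 2 (x, u)) r) := by
  obtain ⟨U, hU, -, hclosed⟩ := hS
  have h1 := h.eventually_iff.and (h.contDiffAt.eventually (by simp))
  have h2 := (continuous_fst_withLp.tendsto
    (WithLp.toLp 2 (x, u) : WithLp 2 (E × F))).eventually h1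
  obtain ⟨r, hr, hrU⟩ := Metric.nhds_basis_closedBall.mem_iff.1 (inter_mem hU h2)
  refine ⟨r, hr, ?_⟩
  have : ProperSpace (WithLp 2 (E × F)) := FiniteDimensional.proper_real _
  refine (isCompact_closedBall _ r).of_isClosed_subset ?_ Set.inter_subset_right
  have hcont : ContinuousOn (fun q : WithLp 2 (E × F) => Φ q.fst)
      (Metric.closedBall (WithLp.toLp 2 (x, u)) r) := fun q hq =>
    (ContinuousAt.comp (f := fun q : WithLp 2 (E × F) => q.fst) (hrU hq).2.2.continuousAt
      continuous_fst_withLp.continuousAt).continuousWithinAt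
  have h3 := (hcont.preimage_isClosed_of_isClosed Metric.isClosed_closedBall
    (isClosed_singleton (x := (0 : Y)))).inter hclosed
  have hset : gph (restrictTo S X) ∩ Metric.closedBall (WithLp.toLp 2 (x, u)) r =
      Metric.closedBall (WithLp.toLp 2 (x, u)) r ∩ (fun q : WithLp 2 (E × F) => Φ q.fst) ⁻¹' {0} ∩
        (gph S ∩ U) := by
    refine Set.Subset.antisymm ?_ ?_
    · rintro q ⟨hqG, hq⟩
      exact ⟨⟨hq, (hrU hq).2.1.1 hqG.1⟩, hqG.2, (hrU hq).1⟩
    · rintro q ⟨⟨hq, hq0⟩, hqS, -⟩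
      exact ⟨⟨(hrU hq).2.1.2 hq0, hqS⟩, hq⟩
  rw [hset]
  exact h3

/-- If the Lipschitz inclusion with constant `κ' > κ` fails at some pair of points, a nearby point of
the graph carries a regular normal of slope at most `κ⁻¹` whose first component is the unit vector
pointing towards the target point. -/
theorem exists_regularNormal_of_not_mem {r δ κ κ' : ℝ}
    (hK : IsCompact (gph (restrictTo S X) ∩ Metric.closedBall (WithLp.toLp 2 (x, u)) r))
    (hκ : 0 < κ) (hκκ' : κ < κ') (hδr : (4 + 2 * κ') * δ < r) {a b : E} {u' : F}
    (hb : b ∈ X) (hu' : u' ∈ S b) (hax : ‖a - x‖ < δ) (hbx : ‖b - x‖ < δ)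
    (hu'u : ‖u' - u‖ < δ)
    (hnot : u' ∉ S a + (κ' * ‖b - a‖) • Metric.closedBall (0 : F) 1) :
    ∃ (p : WithLp 2 (E × F)) (us : F), p ∈ gph (restrictTo S X) ∧ p.fst ≠ a ∧
      ‖p - WithLp.toLp 2 (x, u)‖ ≤ (4 + 2 * κ') * δ ∧ ‖us‖ ≤ κ⁻¹ ∧
      WithLp.toLp 2 (‖a - p.fst‖⁻¹ • (a - p.fst), -us) ∈
        regularNormalCone (gph (restrictTo S X)) p := by
  have hκ' : 0 < κ' := hκ.trans hκκ'
  have hδ : 0 < δ := (norm_nonneg _).trans_lt hax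
  set G := gph (restrictTo S X) with hG
  set ρ := ‖b - a‖ with hρ
  have hρδ : ρ < 2 * δ := by
    calc ρ = ‖(b - x) - (a - x)‖ := by rw [hρ]; congr 1; abel
      _ ≤ ‖b - x‖ + ‖a - x‖ := norm_sub_le _ _
      _ < 2 * δ := by linarith
  have hρ0 : 0 < ρ := by
    rcases (norm_nonneg (b - a)).eq_or_lt with h0 | h0
    · exfalso
      have hba : b = a := sub_eq_zero.1 (norm_eq_zero.1 h0.symm)
      refine hnot ⟨u', hba ▸ hu', 0, ⟨0, by simp, by simp⟩, by simp⟩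
    · exact h0
  have hmem : ∀ v ∈ S a, ‖v - u'‖ ≤ κ' * ρ → False := by
    intro v hv hle
    have hpos : 0 < κ' * ρ := by positivity
    refine hnot ⟨v, hv, u' - v, ⟨(κ' * ρ)⁻¹ • (u' - v), ?_, ?_⟩, by simp⟩
    · rw [mem_closedBall_zero_iff, norm_smul, Real.norm_of_nonneg (by positivity),
        inv_mul_le_iff₀ hpos, mul_one, norm_sub_rev]
      exact hle
    · exact smul_inv_smul₀ hpos.ne' _
  -- Equivalently `(κ * ρ + ε) ^ 2 - ε ^ 2 = (κ' * ρ) ^ 2`: the gap between `κ` and `κ'` absorbs the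
  -- smoothing error.
  obtain ⟨ε, hε, hεeq⟩ : ∃ ε : ℝ, 0 < ε ∧ κ ^ 2 * ρ ^ 2 + 2 * (κ * ρ) * ε = (κ' * ρ) ^ 2 := by
    refine ⟨(κ' ^ 2 - κ ^ 2) * ρ / (2 * κ), ?_, by field_simp; ring⟩
    have : 0 < κ' ^ 2 - κ ^ 2 := by nlinarith
    positivity
  -- Subtracting `ε` gives the starting point `(b, u')` the value `ρ`.
  let f : WithLp 2 (E × F) → ℝ := fun p =>
    √(‖p.fst - a‖ ^ 2 + 0) + κ⁻¹ * (√(‖p.snd - u'‖ ^ 2 + ε ^ 2) - ε)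
  have hfcont : Continuous f := by
    have h1 : Continuous fun p : WithLp 2 (E × F) => p.fst := continuous_fst_withLp
    have h2 : Continuous fun p : WithLp 2 (E × F) => p.snd := continuous_snd_withLp
    fun_prop
  have hball : ∀ v w, ‖v - x‖ + ‖w - u‖ ≤ (4 + 2 * κ') * δ →
      ‖WithLp.toLp 2 (v, w) - WithLp.toLp 2 (x, u)‖ ≤ (4 + 2 * κ') * δ := fun v w hvw =>
    (norm_toLp_le (v - x) (w - u)).trans hvw
  have hp₀ : WithLp.toLp 2 (b, u') ∈ G ∩ Metric.closedBall (WithLp.toLp 2 (x, u)) r := by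
    refine ⟨⟨hb, hu'⟩, ?_⟩
    rw [Metric.mem_closedBall, dist_eq_norm]
    exact (hball b u' (by nlinarith)).trans hδr.le
  obtain ⟨p, ⟨hpG, hpr⟩, hpmin⟩ := hK.exists_isMinOn ⟨_, hp₀⟩ hfcont.continuousOn
  have hfp : f p ≤ ρ := by
    refine (hpmin hp₀).trans (le_of_eq ?_)
    change √(‖b - a‖ ^ 2 + 0) + κ⁻¹ * (√(‖u' - u'‖ ^ 2 + ε ^ 2) - ε) = ρ
    simp [Real.sqrt_sq hε.le, hρ]
  set s := √(‖p.snd - u'‖ ^ 2 + ε ^ 2) with hs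
  have hsle : ‖p.snd - u'‖ ≤ s := Real.le_sqrt_of_sq_le (by nlinarith)
  have hsε : ε ≤ s := Real.le_sqrt_of_sq_le (by nlinarith [norm_nonneg (p.snd - u')])
  have hs0 : 0 < s := hε.trans_le hsε
  have hfp' : ‖p.fst - a‖ + κ⁻¹ * (s - ε) ≤ ρ := by
    have h1 : f p = ‖p.fst - a‖ + κ⁻¹ * (s - ε) := by
      change √(‖p.fst - a‖ ^ 2 + 0) + κ⁻¹ * (s - ε) = _
      rw [add_zero, Real.sqrt_sq (norm_nonneg _)]
    linarith
  have hpa : ‖p.fst - a‖ ≤ ρ := by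
    have : 0 ≤ κ⁻¹ * (s - ε) := mul_nonneg (by positivity) (by linarith)
    linarith
  have hpu : ‖p.snd - u'‖ ≤ κ' * ρ := by
    have h1 : κ⁻¹ * (s - ε) ≤ ρ := by linarith [norm_nonneg (p.fst - a)]
    rw [inv_mul_le_iff₀ hκ] at h1
    have h2 : s ^ 2 ≤ (κ * ρ + ε) ^ 2 := by gcongr; linarith
    rw [hs, Real.sq_sqrt (by positivity)] at h2
    refine le_of_sq_le_sq ?_ (by positivity)
    nlinarith
  -- Otherwise `p.snd ∈ S a` would lie within `κ' * ρ` of `u'`, which the failure of the inclusion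
  -- forbids.
  have hpne : p.fst ≠ a := fun hpa' => hmem p.snd (hpa' ▸ hpG.2) hpu
  have hclose : ‖p - WithLp.toLp 2 (x, u)‖ ≤ (4 + 2 * κ') * δ := by
    refine hball p.fst p.snd ?_
    have h1 : ‖p.fst - x‖ ≤ ‖p.fst - a‖ + ‖a - x‖ := norm_sub_le_norm_sub_add_norm_sub _ _ _
    have h2 : ‖p.snd - u‖ ≤ ‖p.snd - u'‖ + ‖u' - u‖ := norm_sub_le_norm_sub_add_norm_sub _ _ _
    have h3 : κ' * ρ ≤ κ' * (2 * δ) := by gcongr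
    linarith
  -- The minimizer is interior to the ball of radius `r`, so the ball constraint contributes no
  -- normal.
  have hlocal : IsLocalMinOn f G p := by
    have hnhds : Metric.closedBall (WithLp.toLp 2 (x, u)) r ∈ 𝓝 p := by
      refine mem_of_superset (Metric.isOpen_ball.mem_nhds ?_) Metric.ball_subset_closedBall
      rw [Metric.mem_ball, dist_eq_norm]
      exact hclose.trans_lt hδr
    filter_upwards [self_mem_nhdsWithin, nhdsWithin_le_nhds hnhds] with q hqG hq
    exact hpmin ⟨hqG, hq⟩
  have hne : ‖p.fst - a‖ ≠ 0 := norm_ne_zero_iff.2 (sub_ne_zero.2 hpne)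
  have hderiv : HasFDerivAt f _ p :=
    ((hasFDerivAt_sqrt_norm_sub_sq_add a p.fst 0 (by positivity)).comp p
      (WithLp.fstL 2 ℝ E F).hasFDerivAt).add
    ((((hasFDerivAt_sqrt_norm_sub_sq_add u' p.snd (ε ^ 2) (by positivity)).comp p
      (WithLp.sndL 2 ℝ E F).hasFDerivAt).sub_const ε).const_mul κ⁻¹)
  refine ⟨p, (κ⁻¹ * s⁻¹) • (p.snd - u'), hpG, hpne, hclose, ?_, ?_⟩
  · rw [norm_smul, Real.norm_of_nonneg (by positivity), mul_assoc]
    refine mul_le_of_le_one_right (by positivity) ?_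
    rw [inv_mul_le_iff₀ hs0, mul_one]
    exact hsle
  · refine mem_regularNormalCone_of_isLocalMinOn hpG hlocal hderiv fun z => ?_
    rw [WithLp.prod_inner_apply]
    change (√(‖p.fst - a‖ ^ 2 + 0))⁻¹ * ⟪p.fst - a, z.fst⟫ +
      κ⁻¹ * (s⁻¹ * ⟪p.snd - u', z.snd⟫) =
      -(⟪‖a - p.fst‖⁻¹ • (a - p.fst), z.fst⟫ + ⟪-((κ⁻¹ * s⁻¹) • (p.snd - u')), z.snd⟫)
    rw [add_zero, Real.sqrt_sq (norm_nonneg _), norm_sub_rev a, ← neg_sub p.fst a, smul_neg,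
      inner_neg_left, inner_neg_left, real_inner_smul_left, real_inner_smul_left]
    ring

/-- Limits of directions between points of a level set are tangent to it. -/
theorem IsRegularLevelSetAt.fderiv_eq_zero_of_tendsto (h : IsRegularLevelSetAt Φ X x)
    {a b : ℕ → E} {e : E} (ha : Tendsto a atTop (𝓝 x)) (hb : Tendsto b atTop (𝓝 x))
    (haX : ∀ k, a k ∈ X) (hbX : ∀ k, b k ∈ X)
    (he : Tendsto (fun k => ‖a k - b k‖⁻¹ • (a k - b k)) atTop (𝓝 e)) :
    fderiv ℝ Φ x e = 0 := by
  -- Strict differentiability is needed because both endpoints move.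
  have hstrict := (h.contDiffAt.hasStrictFDerivAt (by simp)).isLittleO
  have hlim := ((fderiv ℝ Φ x).continuous.tendsto e).comp he
  refine tendsto_nhds_unique hlim ?_
  rw [Metric.tendsto_nhds]
  intro c hc
  have hab : Tendsto (fun k => (a k, b k)) atTop (𝓝 (x, x)) := ha.prodMk_nhds hb
  filter_upwards [hab.eventually (hstrict.def (half_pos hc)), ha.eventually h.eventually_eq_zero,
    hb.eventually h.eventually_eq_zero] with k h1 h2 h3
  rw [h2 (haX k), h3 (hbX k), sub_zero, zero_sub, norm_neg] at h1
  rw [dist_zero_right, Function.comp_apply, map_smul, norm_smul, norm_inv, norm_norm]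
  calc ‖a k - b k‖⁻¹ * ‖fderiv ℝ Φ x (a k - b k)‖
      ≤ ‖a k - b k‖⁻¹ * (c / 2 * ‖a k - b k‖) := by gcongr
    _ = c / 2 * (‖a k - b k‖⁻¹ * ‖a k - b k‖) := by ring
    _ ≤ c / 2 * 1 := by gcongr; exact inv_mul_le_one
    _ < c := by linarith

variable [FiniteDimensional ℝ E]

/-- Triviality of the tangential part at `0` gives boundedness on the unit ball. -/
theorem exists_norm_lt_of_coderivative_zero (h : IsRegularLevelSetAt Φ X x) (hu : u ∈ S x)
    (h0 : coderivative (restrictTo S X) x u 0 ∩ (fderiv ℝ Φ x).ker = {0}) :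
    ∃ κ : ℝ≥0, ∀ us : F, ‖us‖ ≤ 1 → ∀ xs ∈ coderivative (restrictTo S X) x u us,
      fderiv ℝ Φ x xs = 0 → ‖xs‖ < κ := by
  have hG : WithLp.toLp 2 (x, u) ∈ gph (restrictTo S X) := ⟨h.mem, hu⟩
  by_contra! hfail
  -- Normalizing by `‖xs k‖ → ∞` sends the arguments to `0`, so a limit direction is a unit vector
  -- in the trivial intersection.
  choose us hus xs hxs hker hle using fun k : ℕ => hfail ((k : ℝ≥0) + 1)
  have hle' : ∀ k : ℕ, (k : ℝ) + 1 ≤ ‖xs k‖ := fun k => by simpa using hle k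
  have hpos : ∀ k, 0 < ‖xs k‖ := fun k =>
    (by positivity : (0 : ℝ) < (k : ℝ) + 1).trans_le (hle' k)
  have : ProperSpace E := FiniteDimensional.proper_real _
  obtain ⟨e₀, he₀, φ, hφ, hlim⟩ := (isCompact_sphere (0 : E) 1).tendsto_subseq
    (x := fun k => ‖xs k‖⁻¹ • xs k) fun k => mem_sphere_zero_iff_norm.2
      (norm_smul_inv_norm (𝕜 := ℝ) (norm_pos_iff.1 (hpos k)))
  have hus₀ : Tendsto (fun k => ‖xs k‖⁻¹ • us k) atTop (𝓝 0) := by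
    refine squeeze_zero_norm (fun k => ?_) (tendsto_one_div_add_atTop_nhds_zero_nat (𝕜 := ℝ))
    rw [norm_smul, norm_inv, norm_norm, one_div]
    calc ‖xs k‖⁻¹ * ‖us k‖ ≤ ((k : ℝ) + 1)⁻¹ * 1 := by gcongr; exacts [hle' k, hus k]
      _ = _ := mul_one _
  have hcod : e₀ ∈ coderivative (restrictTo S X) x u 0 := by
    refine mem_normalCone_of_frequently hG ?_
    have hl : Tendsto (fun k => ((WithLp.toLp 2 (x, u) : WithLp 2 (E × F)),
        WithLp.toLp 2 (‖xs (φ k)‖⁻¹ • xs (φ k), -(‖xs (φ k)‖⁻¹ • us (φ k))))) atTop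
        (𝓝 (WithLp.toLp 2 (x, u), WithLp.toLp 2 (e₀, -0))) :=
      tendsto_const_nhds.prodMk_nhds
        (((continuous_toLp_prodMk continuous_fst continuous_snd.neg).tendsto (e₀, (0 : F))).comp
          (hlim.prodMk_nhds (hus₀.comp hφ.tendsto_atTop)))
    exact hl.frequently (Frequently.of_forall fun k =>
      smul_mem_coderivative (hxs (φ k)) (inv_pos.2 (hpos (φ k))))
  have hker₀ : fderiv ℝ Φ x e₀ = 0 := by
    refine tendsto_nhds_unique (((fderiv ℝ Φ x).continuous.tendsto e₀).comp hlim) ?_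
    refine tendsto_const_nhds.congr fun k => ?_
    simp [hker]
  have : e₀ ∈ ({0} : Set E) := h0 ▸ ⟨hcod, hker₀⟩
  rw [Set.mem_singleton_iff.1 this] at he₀
  simp at he₀

variable [FiniteDimensional ℝ F]

theorem lipschitzLikeEstimate_of_norm_lt (h : IsRegularLevelSetAt Φ X x) (hu : u ∈ S x)
    (hS : LocallyClosedAt (gph S) (WithLp.toLp 2 (x, u))) {κ κ' : ℝ≥0} (hκκ' : κ < κ')
    (hnorm : ∀ us : F, ‖us‖ ≤ 1 → ∀ xs ∈ coderivative (restrictTo S X) x u us,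
      fderiv ℝ Φ x xs = 0 → ‖xs‖ < κ) :
    LipschitzLikeEstimate X S x u κ' := by
  have hG : WithLp.toLp 2 (x, u) ∈ gph (restrictTo S X) := ⟨h.mem, hu⟩
  have hκ : (0 : ℝ) < κ := by
    have := hnorm 0 (by simp) 0 (by
      change WithLp.toLp 2 ((0 : E), -(0 : F)) ∈
        normalCone (gph (restrictTo S X)) (WithLp.toLp 2 (x, u))
      rw [neg_zero]
      exact zero_mem_normalCone hG) (map_zero _)
    simpa using this
  by_contra hfail
  obtain ⟨r, hr, hK⟩ := exists_isCompact_gph_inter_closedBall h hS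
  have hM : (0 : ℝ) < 4 + 2 * κ' := by positivity
  -- The shift by `2` makes `(4 + 2 * κ') * δ k < r` strict already at `k = 0`.
  let δ : ℕ → ℝ := fun k => r / (4 + 2 * κ') * (1 / ((k : ℝ) + 2))
  have hδpos : ∀ k, 0 < δ k := fun k => by positivity
  have hδr : ∀ k, (4 + 2 * κ') * δ k < r := fun k => by
    have h1 : (4 + 2 * κ') * δ k = r * (1 / ((k : ℝ) + 2)) := by
      simp only [δ]
      field_simp
    rw [h1]
    refine mul_lt_of_lt_one_right hr ?_
    rw [div_lt_one (by positivity)]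
    linarith [(Nat.cast_nonneg k : (0 : ℝ) ≤ k)]
  have hδlim : Tendsto δ atTop (𝓝 0) := by
    have h1 := (tendsto_one_div_add_atTop_nhds_zero_nat (𝕜 := ℝ)).comp (tendsto_add_atTop_nat 1)
    have h2 := h1.const_mul (r / (4 + 2 * (κ' : ℝ)))
    rw [mul_zero] at h2
    refine h2.congr fun k => ?_
    simp only [Function.comp_apply, δ]
    push_cast
    ring
  have hseq : ∀ k, ∃ (a : E) (p : WithLp 2 (E × F)) (us : F), a ∈ X ∧ ‖a - x‖ < δ k ∧
      p ∈ gph (restrictTo S X) ∧ p.fst ≠ a ∧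
      ‖p - WithLp.toLp 2 (x, u)‖ ≤ (4 + 2 * κ') * δ k ∧ ‖us‖ ≤ (κ : ℝ)⁻¹ ∧
      WithLp.toLp 2 (‖a - p.fst‖⁻¹ • (a - p.fst), -us) ∈
        regularNormalCone (gph (restrictTo S X)) p := by
    intro k
    by_contra hno
    refine hfail ⟨Metric.ball x (δ k), Metric.ball_mem_nhds _ (hδpos k), Metric.ball u (δ k),
      Metric.ball_mem_nhds _ (hδpos k), ?_⟩
    rintro a ⟨haX, ha⟩ b ⟨hbX, hb⟩ u' ⟨hu', hu'W⟩
    rw [Metric.mem_ball, dist_eq_norm] at ha hb hu'W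
    by_contra hnot
    obtain ⟨p, us, hp⟩ := exists_regularNormal_of_not_mem hK hκ (NNReal.coe_lt_coe.2 hκκ')
      (hδr k) hbX hu' ha hb hu'W hnot
    exact hno ⟨a, p, us, haX, ha, hp⟩
  choose a p us haX hax hpG hpa hpx hus hN using hseq
  have ha : Tendsto a atTop (𝓝 x) :=
    tendsto_iff_norm_sub_tendsto_zero.2
      (squeeze_zero (fun _ => norm_nonneg _) (fun k => (hax k).le) hδlim)
  have hp : Tendsto p atTop (𝓝 (WithLp.toLp 2 (x, u))) :=
    tendsto_iff_norm_sub_tendsto_zero.2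
      (squeeze_zero (fun _ => norm_nonneg _) hpx (by simpa using hδlim.const_mul (4 + 2 * (κ' : ℝ))))
  have hpfst : Tendsto (fun k => (p k).fst) atTop (𝓝 x) :=
    (continuous_fst_withLp.tendsto _).comp hp
  let e : ℕ → E := fun k => ‖a k - (p k).fst‖⁻¹ • (a k - (p k).fst)
  have he : ∀ k, ‖e k‖ = 1 := fun k => norm_smul_inv_norm (𝕜 := ℝ)
    (sub_ne_zero.2 (hpa k).symm)
  have : ProperSpace E := FiniteDimensional.proper_real _
  have : ProperSpace F := FiniteDimensional.proper_real _
  obtain ⟨⟨e₀, us₀⟩, ⟨he₀, hus₀⟩, φ, hφ, hlim⟩ :=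
    ((isCompact_sphere (0 : E) 1).prod (isCompact_closedBall (0 : F) (κ : ℝ)⁻¹)).tendsto_subseq
      (x := fun k => (e k, us k))
      (fun k => ⟨mem_sphere_zero_iff_norm.2 (he k), mem_closedBall_zero_iff.2 (hus k)⟩)
  have he₀lim : Tendsto (fun k => e (φ k)) atTop (𝓝 e₀) := (continuous_fst.tendsto _).comp hlim
  have hcod : e₀ ∈ coderivative (restrictTo S X) x u us₀ := by
    refine ⟨hG, fun k => p (φ k), fun k => WithLp.toLp 2 (e (φ k), -us (φ k)),
      fun k => hpG _, hp.comp hφ.tendsto_atTop, fun k => hN _, ?_⟩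
    exact ((continuous_toLp_prodMk continuous_fst continuous_snd.neg).tendsto (e₀, us₀)).comp hlim
  have hker : fderiv ℝ Φ x e₀ = 0 :=
    h.fderiv_eq_zero_of_tendsto (ha.comp hφ.tendsto_atTop) (hpfst.comp hφ.tendsto_atTop)
      (fun k => haX _) (fun k => (hpG _).1) he₀lim
  -- Scaling by `κ` brings the argument into the unit ball and gives the value norm exactly `κ`,
  -- against the strict bound.
  have hlt := hnorm ((κ : ℝ) • us₀) (by
      rw [norm_smul, Real.norm_of_nonneg hκ.le, ← le_inv_mul_iff₀ hκ, mul_one]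
      exact mem_closedBall_zero_iff.1 hus₀)
    ((κ : ℝ) • e₀) (smul_mem_coderivative hcod hκ) (by rw [map_smul, hker, smul_zero])
  rw [norm_smul, mem_sphere_zero_iff_norm.1 he₀, mul_one, Real.norm_of_nonneg hκ.le] at hlt
  exact lt_irrefl _ hlt

end Graph

theorem IsSmoothManifoldAround.exists_isRegularLevelSetAt {n d : ℕ}
    {X : Set (EuclideanSpace ℝ (Fin n))} {x : EuclideanSpace ℝ (Fin n)}
    (h : IsSmoothManifoldAround d X x) :
    ∃ Φ : EuclideanSpace ℝ (Fin n) → EuclideanSpace ℝ (Fin (n - d)),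
      IsRegularLevelSetAt Φ X x := by
  obtain ⟨-, hx, O, Φ, hO, hxO, hΦ, hXO, hsurj⟩ := h
  refine ⟨Φ, hx, hΦ.contDiffAt (hO.mem_nhds hxO), ?_, hsurj⟩
  filter_upwards [hO.mem_nhds hxO] with y hy
  have := Set.ext_iff.1 hXO y
  simpa [hy] using this

/-! ### Outer norm, modulus and the equivalences. -/

section Modulus

variable {E F : Type*} [NormedAddCommGroup E] [NormedAddCommGroup F]

theorem outerNorm_le_iff {G : F → Set E} {κ : ℝ≥0} :
    outerNorm G ≤ κ ↔ ∀ y, ‖y‖ ≤ 1 → ∀ v ∈ G y, ‖v‖ ≤ κ := by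
  simp only [outerNorm, iSup_le_iff, mem_closedBall_zero_iff, enorm_le_coe]
  rfl

variable [InnerProductSpace ℝ F] {X : Set E} {S : E → Set F} {x : E} {u : F}

theorem lipschitzLike_iff_lipModulus_lt_top
    (hS : LocallyClosedAt (gph S) (WithLp.toLp 2 (x, u))) :
    LipschitzLike X S x u ↔ lipModulus X S x u < ⊤ := by
  simp [LipschitzLike, lipModulus, hS, iInf_lt_iff]

end Modulus

section Criterion

variable {E F Y : Type*} [NormedAddCommGroup E] [InnerProductSpace ℝ E]
  [NormedAddCommGroup F] [InnerProductSpace ℝ F] [NormedAddCommGroup Y] [InnerProductSpace ℝ Y]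
  {Φ : E → Y} {X : Set E} {S : E → Set F} {x : E} {u : F}

theorem zero_mem_coderivative_zero (hx : x ∈ X) (hu : u ∈ S x) :
    (0 : E) ∈ coderivative (restrictTo S X) x u 0 := by
  change WithLp.toLp 2 ((0 : E), -(0 : F)) ∈
    normalCone (gph (restrictTo S X)) (WithLp.toLp 2 (x, u))
  rw [neg_zero]
  exact zero_mem_normalCone ⟨hx, hu⟩

variable [FiniteDimensional ℝ E]

/-- The fibre over `0` is a cone, so it is bounded only when trivial; the converse is the
compactness argument of `exists_norm_lt_of_coderivative_zero`. -/
theorem outerNorm_lt_top_iff (h : IsRegularLevelSetAt Φ X x) (hu : u ∈ S x) :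
    outerNorm (fun us => coderivative (restrictTo S X) x u us ∩ (fderiv ℝ Φ x).ker) < ⊤ ↔
      coderivative (restrictTo S X) x u 0 ∩ (fderiv ℝ Φ x).ker = {0} := by
  constructor
  · intro hlt
    obtain ⟨κ, hκ⟩ := ENNReal.lt_iff_exists_coe.1 hlt |>.imp fun _ hκ => hκ.1
    have hle := outerNorm_le_iff.1 hκ.le
    refine Set.eq_singleton_iff_unique_mem.2
      ⟨⟨zero_mem_coderivative_zero h.mem hu, map_zero _⟩, ?_⟩
    rintro v ⟨hv, hker⟩
    by_contra hne
    have hpos : 0 < ‖v‖ := norm_pos_iff.2 hne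
    have ht : 0 < ((κ : ℝ) + 1) / ‖v‖ := by positivity
    have h1 := smul_mem_coderivative hv ht
    rw [smul_zero] at h1
    have hker' : fderiv ℝ Φ x v = 0 := hker
    have h2 := hle 0 (by simp) _ ⟨h1, show fderiv ℝ Φ x _ = 0 by rw [map_smul, hker', smul_zero]⟩
    rw [norm_smul, Real.norm_of_nonneg ht.le, div_mul_cancel₀ _ hpos.ne'] at h2
    linarith
  · intro h0
    obtain ⟨κ, hκ⟩ := exists_norm_lt_of_coderivative_zero h hu h0
    exact (outerNorm_le_iff.2 fun us hus v hv => (hκ us hus v hv.1 hv.2).le).trans_lt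
      ENNReal.coe_lt_top

variable [FiniteDimensional ℝ F] [FiniteDimensional ℝ Y]

theorem coderivative_zero_eq_normalCone_iff (h : IsRegularLevelSetAt Φ X x) (hu : u ∈ S x) :
    coderivative (restrictTo S X) x u 0 = normalCone X x ↔
      coderivative (restrictTo S X) x u 0 ∩ (fderiv ℝ Φ x).ker = {0} := by
  constructor
  · intro heq
    refine Set.eq_singleton_iff_unique_mem.2
      ⟨⟨zero_mem_coderivative_zero h.mem hu, map_zero _⟩, ?_⟩
    rintro v ⟨hv, hker⟩
    exact h.eq_zero_of_mem_normalCone_of_mem_ker (heq ▸ hv) hker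
  · intro h0
    ext v
    rw [h.mem_normalCone_iff_exists]
    constructor
    · intro hv
      obtain ⟨l, hl⟩ := exists_sub_adjoint_mem_ker (fderiv ℝ Φ x) v
      have h1 := add_adjoint_mem_coderivative h hv (-l)
      rw [map_neg, ← sub_eq_add_neg] at h1
      have h2 : v - ContinuousLinearMap.adjoint (fderiv ℝ Φ x) l ∈ ({0} : Set E) := h0 ▸ ⟨h1, hl⟩
      exact ⟨l, (sub_eq_zero.1 h2).symm⟩
    · rintro ⟨l, rfl⟩
      simpa using add_adjoint_mem_coderivative h (zero_mem_coderivative_zero h.mem hu) l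

theorem lipModulus_eq (h : IsRegularLevelSetAt Φ X x) (hu : u ∈ S x)
    (hS : LocallyClosedAt (gph S) (WithLp.toLp 2 (x, u))) :
    lipModulus X S x u =
      outerNorm (fun us => coderivative (restrictTo S X) x u us ∩ (fderiv ℝ Φ x).ker) := by
  refine le_antisymm (le_of_forall_gt fun c hc => ?_) (le_iInf₂ fun κ hκ => ?_)
  · obtain ⟨κ₀, h0, h1⟩ := ENNReal.lt_iff_exists_nnreal_btwn.1 hc
    obtain ⟨κ', h2, h3⟩ := ENNReal.lt_iff_exists_nnreal_btwn.1 h1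
    obtain ⟨κ, h4, h5⟩ := ENNReal.lt_iff_exists_nnreal_btwn.1 h2
    refine (iInf₂_le κ' (lipschitzLikeEstimate_of_norm_lt h hu hS (κ := κ)
      (ENNReal.coe_lt_coe.1 h5) fun us hus xs hxs hker => ?_)).trans_lt h3
    exact (outerNorm_le_iff.1 h0.le us hus xs ⟨hxs, hker⟩).trans_lt
      (NNReal.coe_lt_coe.2 (ENNReal.coe_lt_coe.1 h4))
  · refine outerNorm_le_iff.2 fun us hus xs hxs => ?_
    refine (norm_le_of_lipschitzLikeEstimate h hκ hxs.1 hxs.2).trans ?_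
    exact mul_le_of_le_one_right κ.coe_nonneg hus

end Criterion

end VarAnal

theorem theorem4p3 {n m d : ℕ}
    (S : EuclideanSpace ℝ (Fin n) → Set (EuclideanSpace ℝ (Fin m)))
    (X : Set (EuclideanSpace ℝ (Fin n)))
    (xbar : EuclideanSpace ℝ (Fin n)) (ubar : EuclideanSpace ℝ (Fin m))
    (hX : VarAnal.IsSmoothManifoldAround d X xbar)
    (hubar : ubar ∈ S xbar)
    (hS : VarAnal.LocallyClosedAt (VarAnal.gph S) (WithLp.toLp 2 (xbar, ubar))) :
    List.TFAE
      [ VarAnal.LipschitzLike X S xbar ubar,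
        VarAnal.projSet (VarAnal.tangentCone X xbar)
          (VarAnal.coderivative (VarAnal.restrictTo S X) xbar ubar 0) = {0},
        VarAnal.outerNorm (fun us => VarAnal.projSet (VarAnal.tangentCone X xbar)
          (VarAnal.coderivative (VarAnal.restrictTo S X) xbar ubar us)) < ⊤,
        VarAnal.coderivative (VarAnal.restrictTo S X) xbar ubar 0 ∩
          VarAnal.tangentCone X xbar = {0},
        VarAnal.coderivative (VarAnal.restrictTo S X) xbar ubar 0 =
          VarAnal.normalCone X xbar,
        VarAnal.projCoderivative X S xbar ubar 0 = {0} ] ∧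
    VarAnal.lipModulus X S xbar ubar =
      VarAnal.outerNorm (fun us => VarAnal.projSet (VarAnal.tangentCone X xbar)
        (VarAnal.coderivative (VarAnal.restrictTo S X) xbar ubar us)) := by
  obtain ⟨Φ, h⟩ := hX.exists_isRegularLevelSetAt
  -- All conditions, including (a) via finiteness of the modulus, reduce to triviality of the
  -- coderivative at `0` within the kernel.
  simp only [VarAnal.projSet_coderivative_eq h, VarAnal.projCoderivative_eq h hubar,
    VarAnal.lipschitzLike_iff_lipModulus_lt_top hS, VarAnal.lipModulus_eq h hubar hS,
    VarAnal.outerNorm_lt_top_iff h hubar, VarAnal.coderivative_zero_eq_normalCone_iff h hubar]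
  simp [h.tangentCone_eq_ker]
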